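/- Let $\mu>\tfrac12$ be real and let $a\in\mathbb{C}\setminus\{0\}$ satisfy $|\arg a|<\tfrac{\pi}{2}$. For $\operatorname{Re} z>0$ and $\nu\in\mathbb{C}$ let $$K_\nu(z)=\int_0^\infty e^{-z\cosh t}\cosh(\nu t)\,dt$$ denote the modified Bessel function of the second kind; all complex powers take their principal values. Then both series below converge absolutely and $$\sum_{n=0}^\infty\frac{1}{(n^2+a^2)^{\mu}}=\frac{1}{2a^{2\mu}}+\frac{\sqrt{\pi}\,\Gamma(\mu-\tfrac12)}{2a^{2\mu-1}\,\Gamma(\mu)}+\frac{2^{\frac32-\mu}\sqrt{\pi}}{a^{2\mu-1}\,\Gamma(\mu)}\sum_{k=0}^\infty\frac{K_{\frac12-\mu}\big((2k+2)\pi a\big)}{\big((2k+2)\pi a\big)^{\frac12-\mu}}.$$ -/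

import Mathlib

/-- The modified Bessel function of the second kind (Macdonald function) `K_ν(z)` of complex
order `ν`, on the half-plane `Re z > 0`, where it is given by the absolutely convergent integral
`∫₀^∞ exp (-z cosh t) cosh (ν t) dt`. (It is only used at arguments with `Re z > 0`.) -/
noncomputable def besselK (ν z : ℂ) : ℂ :=
  ∫ t in Set.Ioi (0 : ℝ), Complex.exp (-z * (Real.cosh t : ℂ)) * Complex.cosh (ν * (t : ℂ))

/-! For real `A > 0`, each `(n² + A²)^(-μ)` is, up to `Γ(μ)`, the integral of `t^(μ-1) exp (-(n² +
A²) t)` over `t > 0`. Summing over `n ∈ ℤ` inside the integral and applying the Jacobi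
transformation (`tsum_theta`) turns the Gaussian sum into one in `exp (-π² k² / t)`, with a factor
`t^(-1/2)` that lowers the Mellin exponent to `μ - 1/2`. Frequency `0` yields the Gamma quotient
(`dualIntegral_zero`), the others yield Macdonald functions (`dualIntegral_succ`). Folding `ℤ` onto
`ℕ` leaves half of the `n = 0` term as `1 / (2 A^(2μ))`.

The condition on `arg a` says `Re a > 0`. On that half-plane both sides are locally uniform limits
of holomorphic terms, so the identity theorem extends the formula from the positive reals. -/

open Complex MeasureTheory Set Filter Topology

/-! ### Bounds and holomorphy of the Macdonald function -/

/-- The exponential decay that dominates all Macdonald integrands. -/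
lemma exists_exp_mul_sub_cosh_le (c : ℝ) {δ : ℝ} (hδ : 0 < δ) :
    ∃ M : ℝ, ∀ t : ℝ, 0 ≤ t → Real.exp (c * t - δ * Real.cosh t) ≤ M * Real.exp (-1 * t) := by
  -- Since `cosh t ≥ t²/4`, completing the square bounds `(c + 1) t - δ t²/4` by this exponent.
  refine ⟨Real.exp ((c + 1) ^ 2 / δ), fun t ht => ?_⟩
  rw [← Real.exp_add]
  apply Real.exp_le_exp.2
  have h1 : t ^ 2 / 4 ≤ Real.cosh t := by
    have h2 := Real.quadratic_le_exp_of_nonneg ht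
    have h3 := Real.exp_pos (-t)
    rw [Real.cosh_eq]
    nlinarith
  have h2 : δ * (t ^ 2 / 4) ≤ δ * Real.cosh t := by gcongr
  have h3 : (c + 1) ^ 2 / δ + δ * (t ^ 2 / 4) - (c + 1) * t = ((c + 1) - δ * t / 2) ^ 2 / δ := by
    field_simp
    ring
  have h4 : 0 ≤ ((c + 1) - δ * t / 2) ^ 2 / δ := by positivity
  linarith

lemma integrableOn_exp_mul_sub_cosh (c : ℝ) {δ : ℝ} (hδ : 0 < δ) :
    IntegrableOn (fun t : ℝ => Real.exp (c * t - δ * Real.cosh t)) (Ioi 0) := by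
  obtain ⟨M, hM⟩ := exists_exp_mul_sub_cosh_le c hδ
  refine Integrable.mono' ((integrableOn_exp_mul_Ioi (by norm_num : (-1 : ℝ) < 0) 0).const_mul M)
    (by fun_prop) ?_
  filter_upwards [ae_restrict_mem measurableSet_Ioi] with t ht
  rw [Real.norm_of_nonneg (Real.exp_pos _).le]
  exact hM t (le_of_lt ht)

lemma norm_cosh_mul_ofReal_le (ν : ℂ) {t : ℝ} (ht : 0 ≤ t) :
    ‖Complex.cosh (ν * t)‖ ≤ Real.exp (|ν.re| * t) := by
  have h1 : ‖Complex.exp (ν * t)‖ ≤ Real.exp (|ν.re| * t) := by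
    rw [Complex.norm_exp, Complex.re_mul_ofReal]
    gcongr
    exact le_abs_self _
  have h2 : ‖Complex.exp (-(ν * t))‖ ≤ Real.exp (|ν.re| * t) := by
    rw [Complex.norm_exp, Complex.neg_re, Complex.re_mul_ofReal, ← neg_mul]
    gcongr
    exact neg_le_abs _
  rw [Complex.cosh, norm_div, Complex.norm_ofNat]
  linarith [norm_add_le (Complex.exp (ν * t)) (Complex.exp (-(ν * t)))]

/-- Only `δ cosh t` is kept for integrability in `t`; the rest, `(Re z - δ) cosh t ≥ Re z - δ`,
supplies decay in `z`. -/
lemma norm_besselK_integrand_le (ν : ℂ) {δ : ℝ} {z : ℂ} (hz : δ ≤ z.re) {t : ℝ} (ht : 0 ≤ t) :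
    ‖Complex.exp (-z * (Real.cosh t : ℂ)) * Complex.cosh (ν * (t : ℂ))‖ ≤
      Real.exp (δ - z.re) * Real.exp (|ν.re| * t - δ * Real.cosh t) := by
  rw [norm_mul, Complex.norm_exp, Complex.re_mul_ofReal, Complex.neg_re]
  refine (mul_le_mul_of_nonneg_left (norm_cosh_mul_ofReal_le ν ht) (Real.exp_pos _).le).trans ?_
  rw [← Real.exp_add, ← Real.exp_add]
  apply Real.exp_le_exp.2
  nlinarith [Real.one_le_cosh t]

lemma integrableOn_besselK_integrand (ν : ℂ) {z : ℂ} (hz : 0 < z.re) :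
    IntegrableOn (fun t : ℝ => Complex.exp (-z * (Real.cosh t : ℂ)) * Complex.cosh (ν * (t : ℂ)))
      (Ioi 0) := by
  refine Integrable.mono' ((integrableOn_exp_mul_sub_cosh |ν.re| hz).const_mul
    (Real.exp (z.re - z.re))) (by fun_prop) ?_
  filter_upwards [ae_restrict_mem measurableSet_Ioi] with t ht
  exact norm_besselK_integrand_le ν le_rfl (le_of_lt ht)

/-- Exponential decay of the Macdonald function, uniform on half-planes. -/
lemma exists_norm_besselK_le (ν : ℂ) {δ : ℝ} (hδ : 0 < δ) :
    ∃ C : ℝ, 0 ≤ C ∧ ∀ z : ℂ, δ ≤ z.re → ‖besselK ν z‖ ≤ C * Real.exp (-z.re) := by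
  refine ⟨Real.exp δ * ∫ t in Ioi (0 : ℝ), Real.exp (|ν.re| * t - δ * Real.cosh t),
    by positivity, fun z hz => ?_⟩
  have h := norm_integral_le_of_norm_le ((integrableOn_exp_mul_sub_cosh |ν.re| hδ).const_mul
    (Real.exp (δ - z.re))) (f := fun t : ℝ => Complex.exp (-z * (Real.cosh t : ℂ)) *
      Complex.cosh (ν * (t : ℂ))) (by
    filter_upwards [ae_restrict_mem measurableSet_Ioi] with t ht
    exact norm_besselK_integrand_le ν hz (le_of_lt ht))
  rw [integral_const_mul, sub_eq_add_neg, Real.exp_add] at h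
  unfold besselK
  linarith

lemma differentiableAt_besselK (ν : ℂ) {z : ℂ} (hz : 0 < z.re) :
    DifferentiableAt ℂ (besselK ν) z := by
  have hz2 : 0 < z.re / 2 := by linarith
  have key := hasDerivAt_integral_of_dominated_loc_of_deriv_le
    (μ := volume.restrict (Ioi (0 : ℝ))) (s := {w : ℂ | z.re / 2 < w.re}) (x₀ := z)
    (F := fun w t => Complex.exp (-w * (Real.cosh t : ℂ)) * Complex.cosh (ν * (t : ℂ)))
    (F' := fun w t => Complex.exp (-w * (Real.cosh t : ℂ)) * (-(Real.cosh t : ℂ)) *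
      Complex.cosh (ν * (t : ℂ)))
    -- The extra `1` in the exponent absorbs the factor `cosh t ≤ exp t` produced by
    -- differentiation.
    (bound := fun t => Real.exp ((1 + |ν.re|) * t - z.re / 2 * Real.cosh t))
    ((isOpen_lt continuous_const Complex.continuous_re).mem_nhds (by simp; linarith))
    (Eventually.of_forall fun w => by fun_prop)
    (integrableOn_besselK_integrand ν hz) (by fun_prop) ?_
    (integrableOn_exp_mul_sub_cosh _ hz2) ?_
  · exact key.2.differentiableAt
  · filter_upwards [ae_restrict_mem measurableSet_Ioi] with t ht w hw
    have ht : 0 ≤ t := le_of_lt ht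
    have h1 := norm_besselK_integrand_le ν (le_refl w.re) ht
    have h2 : ‖(-(Real.cosh t : ℂ))‖ ≤ Real.exp t := by
      rw [norm_neg, Complex.norm_real, Real.norm_of_nonneg (Real.cosh_pos t).le, Real.cosh_eq]
      have : Real.exp (-t) ≤ Real.exp t := Real.exp_le_exp.2 (by linarith)
      linarith
    rw [mul_right_comm, norm_mul]
    refine (mul_le_mul h1 h2 (norm_nonneg _) (by positivity)).trans ?_
    rw [← Real.exp_add, ← Real.exp_add]
    apply Real.exp_le_exp.2
    have hw : z.re / 2 < w.re := hw
    nlinarith [Real.one_le_cosh t]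
  · refine Eventually.of_forall fun t w _ => ?_
    refine HasDerivAt.mul_const ?_ _
    simpa using ((hasDerivAt_id w).neg.mul_const (Real.cosh t : ℂ)).cexp

lemma besselK_neg (ν z : ℂ) : besselK (-ν) z = besselK ν z := by
  simp [besselK, Complex.cosh_neg]

/-! ### Mellin-type integrals at positive arguments -/

/-- Integral of a function on `(0, ∞)` after the substitution `s = c eᵗ`. -/
lemma integral_Ioi_comp_mul_exp {c : ℝ} (hc : 0 < c) (f : ℝ → ℝ) :
    ∫ s in Ioi (0 : ℝ), f s = ∫ t : ℝ, c * Real.exp t * f (c * Real.exp t) := by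
  have himg : (fun t : ℝ => c * Real.exp t) '' univ = Ioi 0 := by
    ext s
    simp only [image_univ, mem_range, mem_Ioi]
    constructor
    · rintro ⟨t, rfl⟩
      positivity
    · intro hs
      exact ⟨Real.log (s / c), by rw [Real.exp_log (by positivity)]; field_simp⟩
  rw [← himg, integral_image_eq_integral_abs_deriv_smul MeasurableSet.univ
    (f' := fun t => c * Real.exp t)
    (fun t _ => ((Real.hasDerivAt_exp t).const_mul c).hasDerivWithinAt)
    (fun t _ s _ h => Real.exp_injective (mul_left_cancel₀ hc.ne' h))]
  simp only [Measure.restrict_univ, smul_eq_mul]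
  congr 1
  ext t
  rw [abs_of_pos (by positivity)]

lemma integrable_exp_mul_sub_cosh (ν : ℝ) {x : ℝ} (hx : 0 < x) :
    Integrable (fun t : ℝ => Real.exp (ν * t - x * Real.cosh t)) := by
  rw [← integrableOn_univ, ← Iic_union_Ioi (a := (0 : ℝ)), integrableOn_union]
  refine ⟨?_, integrableOn_exp_mul_sub_cosh ν hx⟩
  have h := (integrableOn_exp_mul_sub_cosh (-ν) hx)
  rw [← neg_zero, ← integrableOn_Ici_iff_integrableOn_Ioi] at h
  have := h.comp_neg_Iic
  simpa using this

lemma integral_exp_mul_sub_cosh (ν : ℝ) {x : ℝ} (hx : 0 < x) :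
    ((∫ t : ℝ, Real.exp (ν * t - x * Real.cosh t) : ℝ) : ℂ) = 2 * besselK ν x := by
  have hi := integrable_exp_mul_sub_cosh ν hx
  have h1 := intervalIntegral.integral_Iic_add_Ioi (b := (0 : ℝ)) hi.integrableOn hi.integrableOn
  have h2 := integral_comp_neg_Ioi 0 (fun t : ℝ => Real.exp (ν * t - x * Real.cosh t))
  rw [neg_zero] at h2
  rw [← h1, ← h2, ← integral_add (by simpa [IntegrableOn] using integrableOn_exp_mul_sub_cosh (-ν) hx)
    hi.integrableOn, besselK, ← integral_const_mul, ← integral_complex_ofReal]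
  congr 1
  ext t
  have h3 : Complex.exp (-(x : ℂ) * (Real.cosh t : ℂ)) * Complex.cosh ((ν : ℂ) * (t : ℂ)) =
      ((Real.exp (-x * Real.cosh t) * Real.cosh (ν * t) : ℝ) : ℂ) := by push_cast; rfl
  rw [h3]
  norm_cast
  rw [Real.cosh_eq (ν * t), Real.cosh_neg, sub_eq_add_neg, sub_eq_add_neg, Real.exp_add,
    Real.exp_add]
  ring_nf

/-- The Mellin-type representation
`∫₀^∞ s^(ν-1) exp (-(x/2)(s/c + c/s)) ds = 2 c^ν K_ν(x)`. -/
lemma integral_rpow_mul_exp_eq_besselK (ν : ℝ) {x c : ℝ} (hx : 0 < x) (hc : 0 < c) :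
    ((∫ s in Ioi (0 : ℝ), s ^ (ν - 1) * Real.exp (-(x / 2 * (s / c + c / s))) : ℝ) : ℂ) =
      2 * ((c ^ ν : ℝ) : ℂ) * besselK ν x := by
  rw [mul_comm (2 : ℂ), mul_assoc, ← integral_exp_mul_sub_cosh ν hx, ← Complex.ofReal_mul,
    ← integral_const_mul, integral_Ioi_comp_mul_exp hc]
  congr 2
  ext t
  have he := Real.exp_pos t
  have h1 : x / 2 * (c * Real.exp t / c + c / (c * Real.exp t)) = x * Real.cosh t := by
    rw [Real.cosh_eq, Real.exp_neg]
    field_simp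
  rw [h1, ← mul_assoc, sub_eq_add_neg (ν * t), Real.exp_add, ← mul_assoc]
  congr 1
  have h2 : 0 < c * Real.exp t := by positivity
  rw [Real.rpow_sub_one h2.ne', mul_div_cancel₀ _ h2.ne', Real.mul_rpow hc.le he.le,
    ← Real.exp_mul, mul_comm t]

/-! ### Summable majorants, uniform for `Re a ≥ δ` and `‖a‖ ≤ R` -/

/-- Factor `n² + a² = (n + ia)(n - ia)`. Each factor has norm at least `δ` (imaginary part `± Re a`)
and at least `n - R`; the constant `δ / (R + 1 + δ)` combines the two bounds. -/
lemma norm_sq_add_sq_ge {δ R : ℝ} (hδ : 0 < δ) (hR : 0 ≤ R) (n : ℕ) {a : ℂ} (ha : δ ≤ a.re)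
    (haR : ‖a‖ ≤ R) :
    (δ / (R + 1 + δ) * (n + 1)) ^ 2 ≤ ‖(n : ℂ) ^ 2 + a ^ 2‖ := by
  have key : ∀ w : ℂ, ‖w‖ ≤ R → δ ≤ |w.im| → δ / (R + 1 + δ) * (n + 1) ≤ ‖(n : ℂ) + w‖ := by
    intro w hw hwi
    have h1 : δ ≤ ‖(n : ℂ) + w‖ := hwi.trans (by simpa using Complex.abs_im_le_norm ((n : ℂ) + w))
    have h2 : (n : ℝ) ≤ ‖(n : ℂ) + w‖ + R := by
      have h := norm_sub_le ((n : ℂ) + w) w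
      rw [add_sub_cancel_right, Complex.norm_natCast] at h
      linarith
    rw [div_mul_eq_mul_div, div_le_iff₀ (by positivity)]
    nlinarith
  have h1 := key (a * I) (by simpa using haR) (by simpa using ha.trans (le_abs_self _))
  have h2 := key (-(a * I)) (by simpa using haR) (by simpa using ha.trans (le_abs_self _))
  have h3 : (n : ℂ) ^ 2 + a ^ 2 = ((n : ℂ) + a * I) * ((n : ℂ) + -(a * I)) := by
    ring_nf
    rw [I_sq]
    ring
  rw [h3, norm_mul, sq]
  exact mul_le_mul h1 h2 (by positivity) (norm_nonneg _)

lemma exists_summable_norm_sq_add_sq_cpow_le {μ : ℝ} (hμ : 1 / 2 < μ) {δ R : ℝ} (hδ : 0 < δ)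
    (hR : 0 ≤ R) :
    ∃ u : ℕ → ℝ, Summable u ∧ ∀ (n : ℕ) (a : ℂ), δ ≤ a.re → ‖a‖ ≤ R →
      ‖((n : ℂ) ^ 2 + a ^ 2) ^ (-(μ : ℂ))‖ ≤ u n := by
  refine ⟨fun n => ((δ / (R + 1 + δ) * (n + 1)) ^ 2) ^ (-μ), ?_, fun n a ha haR => ?_⟩
  · have h1 : Summable fun n : ℕ => ((n + 1 : ℕ) : ℝ) ^ (-(2 * μ)) :=
      (summable_nat_add_iff 1).2 (Real.summable_nat_rpow.2 (by linarith))
    refine (h1.mul_left ((δ / (R + 1 + δ)) ^ (-(2 * μ)))).congr fun n => ?_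
    rw [← Real.rpow_natCast, ← Real.rpow_mul (by positivity),
      Real.mul_rpow (by positivity) (by positivity)]
    push_cast
    ring_nf
  · rw [← Complex.ofReal_neg, Complex.norm_cpow_real]
    exact Real.rpow_le_rpow_of_nonpos (by positivity) (norm_sq_add_sq_ge hδ hR n ha haR)
      (by linarith)

lemma summable_exp_neg_mul_rpow {b : ℝ} (hb : 0 < b) (s : ℝ) :
    Summable fun k : ℕ => Real.exp (-b * ((k : ℝ) + 1)) * ((k : ℝ) + 1) ^ s := by
  have h1 : Summable fun k : ℕ => Real.exp (-b * (k : ℝ)) * (k : ℝ) ^ s := by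
    refine summable_of_isBigO_nat
      (Real.summable_nat_rpow.2 (by norm_num : (-2 : ℝ) < -1)) ?_
    -- The exponent `-2 - s` is chosen so that multiplying by `k^s` leaves the summable `k^(-2)`.
    have h := ((isLittleO_exp_neg_mul_rpow_atTop hb (-2 - s)).isBigO.mul
      (Asymptotics.isBigO_refl (fun x : ℝ => x ^ s) atTop)).comp_tendsto tendsto_natCast_atTop_atTop
    refine h.trans (Eventually.isBigO ?_)
    filter_upwards [eventually_gt_atTop 0] with k hk
    have hk : (0 : ℝ) < k := Nat.cast_pos.2 hk
    simp only [Function.comp_apply]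
    rw [← Real.rpow_add hk, Real.norm_of_nonneg (by positivity)]
    simp
  simpa using (summable_nat_add_iff 1).2 h1

/-- As `s ≤ 0`, dividing by the power means multiplying by a nonnegative power of the norm, which
grows polynomially in `k` and loses to the exponential decay of `besselK`. -/
lemma exists_summable_norm_besselK_div_cpow_le (ν : ℂ) {s : ℝ} (hs : s ≤ 0) {δ R : ℝ}
    (hδ : 0 < δ) (hR : 0 ≤ R) :
    ∃ u : ℕ → ℝ, Summable u ∧ ∀ (k : ℕ) (a : ℂ), δ ≤ a.re → ‖a‖ ≤ R →
      ‖besselK ν ((2 * (k : ℂ) + 2) * (Real.pi : ℂ) * a) /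
        ((2 * (k : ℂ) + 2) * (Real.pi : ℂ) * a) ^ (s : ℂ)‖ ≤ u k := by
  have hπ := Real.pi_pos
  obtain ⟨C, hC, hK⟩ := exists_norm_besselK_le ν (δ := 2 * Real.pi * δ) (by positivity)
  refine ⟨fun k => C * (2 * Real.pi * R) ^ (-s) *
    (Real.exp (-(2 * Real.pi * δ) * ((k : ℝ) + 1)) * ((k : ℝ) + 1) ^ (-s)),
    (summable_exp_neg_mul_rpow (by positivity) _).mul_left _, fun k a ha haR => ?_⟩
  have hz : (2 * (k : ℂ) + 2) * (Real.pi : ℂ) * a =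
      ((2 * Real.pi * ((k : ℝ) + 1) : ℝ) : ℂ) * a := by
    push_cast
    ring
  have hx : 0 < 2 * Real.pi * ((k : ℝ) + 1) := by positivity
  have hre : (2 * Real.pi * δ) * ((k : ℝ) + 1) ≤
      (((2 * Real.pi * ((k : ℝ) + 1) : ℝ) : ℂ) * a).re := by
    rw [Complex.re_ofReal_mul]
    nlinarith
  rw [hz, norm_div, Complex.norm_cpow_real, norm_mul, Complex.norm_real,
    Real.norm_of_nonneg hx.le, div_eq_mul_inv, ← Real.rpow_neg (by positivity)]
  have h1 : ‖besselK ν (((2 * Real.pi * ((k : ℝ) + 1) : ℝ) : ℂ) * a)‖ ≤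
      C * Real.exp (-(2 * Real.pi * δ) * ((k : ℝ) + 1)) := by
    refine (hK _ (le_trans ?_ hre)).trans ?_
    · have : 0 ≤ 2 * Real.pi * δ * k := by positivity
      linarith
    · gcongr
      linarith
  have h2 : (2 * Real.pi * ((k : ℝ) + 1) * ‖a‖) ^ (-s) ≤
      (2 * Real.pi * R) ^ (-s) * ((k : ℝ) + 1) ^ (-s) := by
    rw [← Real.mul_rpow (by positivity) (by positivity)]
    apply Real.rpow_le_rpow (by positivity) _ (by linarith)
    nlinarith [mul_le_mul_of_nonneg_left haR hx.le]
  calc _ ≤ _ := mul_le_mul h1 h2 (by positivity) (by positivity)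
    _ = _ := by ring

/-! ### Theta transformation and its termwise Mellin integrals -/

lemma tsum_theta {t : ℝ} (ht : 0 < t) :
    ∑' n : ℤ, Real.exp (-((n : ℝ) ^ 2 * t)) =
      Real.sqrt Real.pi * t ^ (-(1 / 2) : ℝ) *
        ∑' n : ℤ, Real.exp (-(Real.pi ^ 2 * (n : ℝ) ^ 2 / t)) := by
  have hπ := Real.pi_pos
  have h := Real.tsum_exp_neg_mul_int_sq (a := t / Real.pi) (by positivity)
  convert h using 3 with n
  · congr 1
    field_simp
  · rw [Real.div_rpow ht.le hπ.le, Real.sqrt_eq_rpow, Real.rpow_neg ht.le]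
    field_simp
  · ext n
    congr 1
    field_simp

/-- Integral of the terms of the theta series. -/
lemma integral_rpow_mul_exp_sq_add_sq {μ A : ℝ} (hμ : 0 < μ) (hA : 0 < A) (n : ℤ) :
    ∫ t in Ioi (0 : ℝ), t ^ (μ - 1) * Real.exp (-(((n : ℝ) ^ 2 + A ^ 2) * t)) =
      Real.Gamma μ * ((n : ℝ) ^ 2 + A ^ 2) ^ (-μ) := by
  rw [Real.integral_rpow_mul_exp_neg_mul_Ioi hμ (by positivity), one_div,
    Real.inv_rpow (by positivity), Real.rpow_neg (by positivity), mul_comm]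

/-- The integral of the `k`-th term on the dual side of the theta transformation. -/
noncomputable def dualIntegral (r A : ℝ) (k : ℤ) : ℝ :=
  ∫ t in Ioi (0 : ℝ), t ^ (r - 1) * Real.exp (-(A ^ 2 * t + Real.pi ^ 2 * (k : ℝ) ^ 2 / t))

lemma integrableOn_dualIntegral {r A : ℝ} (hr : 0 < r) (hA : 0 < A) (k : ℤ) :
    IntegrableOn (fun t : ℝ => t ^ (r - 1) *
      Real.exp (-(A ^ 2 * t + Real.pi ^ 2 * (k : ℝ) ^ 2 / t))) (Ioi 0) := by
  have h0 : IntegrableOn (fun t : ℝ => t ^ (r - 1) * Real.exp (-(A ^ 2 * t))) (Ioi 0) := by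
    -- A non-integrable function would have Bochner integral `0`, whereas this one has a positive
    -- value.
    refine .of_integral_ne_zero ?_
    rw [Real.integral_rpow_mul_exp_neg_mul_Ioi hr (by positivity)]
    have := Real.Gamma_pos_of_pos hr
    positivity
  refine Integrable.mono' h0 (by fun_prop) ?_
  filter_upwards [ae_restrict_mem measurableSet_Ioi] with t ht
  have ht : 0 < t := ht
  rw [Real.norm_of_nonneg (by positivity)]
  gcongr
  have : 0 ≤ Real.pi ^ 2 * (k : ℝ) ^ 2 / t := by positivity
  linarith

lemma dualIntegral_neg (r A : ℝ) (k : ℤ) : dualIntegral r A (-k) = dualIntegral r A k := by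
  simp [dualIntegral]

lemma dualIntegral_zero {r A : ℝ} (hr : 0 < r) (hA : 0 < A) :
    dualIntegral r A 0 = A ^ (-(2 * r)) * Real.Gamma r := by
  have h := Real.integral_rpow_mul_exp_neg_mul_Ioi hr (by positivity : 0 < A ^ 2)
  have h2 : (1 / A ^ 2) ^ r = A ^ (-(2 * r)) := by
    rw [one_div, Real.inv_rpow (by positivity), Real.rpow_neg hA.le, ← Real.rpow_natCast,
      ← Real.rpow_mul hA.le]
    norm_num
  rw [← h2, ← h, dualIntegral]
  simp

/-- The exponent `A² t + π² (k+1)² / t` is balanced at `t = c = π (k+1) / A`; rescaling by `c` gives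
the Mellin-type representation with `x = 2π (k+1) A`. Evenness in the order replaces `r` by `-r`. -/
lemma dualIntegral_succ {r A : ℝ} (hA : 0 < A) (k : ℕ) :
    (dualIntegral r A ((k : ℤ) + 1) : ℂ) =
      ((2 ^ (1 - r) * A ^ (-(2 * r)) : ℝ) : ℂ) *
        (besselK (-r : ℝ) ((2 * (k : ℂ) + 2) * (Real.pi : ℂ) * A) /
          ((2 * (k : ℂ) + 2) * (Real.pi : ℂ) * A) ^ ((-r : ℝ) : ℂ)) := by
  have hπ := Real.pi_pos
  have hc : 0 < Real.pi * ((k : ℝ) + 1) / A := by positivity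
  have hx : 0 < (2 * (k : ℝ) + 2) * Real.pi * A := by positivity
  have h := integral_rpow_mul_exp_eq_besselK r hx hc
  have hz : (2 * (k : ℂ) + 2) * (Real.pi : ℂ) * A =
      (((2 * (k : ℝ) + 2) * Real.pi * A : ℝ) : ℂ) := by push_cast; rfl
  have hd : dualIntegral r A ((k : ℤ) + 1) = ∫ s in Ioi (0 : ℝ), s ^ (r - 1) *
      Real.exp (-((2 * (k : ℝ) + 2) * Real.pi * A / 2 * (s / (Real.pi * ((k : ℝ) + 1) / A) +
        Real.pi * ((k : ℝ) + 1) / A / s))) := by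
    refine setIntegral_congr_fun measurableSet_Ioi fun s hs => ?_
    have hs : 0 < s := hs
    congr 3
    push_cast
    field_simp
  have hpow : 2 * (Real.pi * ((k : ℝ) + 1) / A) ^ r * ((2 * (k : ℝ) + 2) * Real.pi * A) ^ (-r) =
      2 ^ (1 - r) * A ^ (-(2 * r)) := by
    have e : (2 * (k : ℝ) + 2) * Real.pi * A = 2 * A ^ 2 * (Real.pi * ((k : ℝ) + 1) / A) := by
      field_simp
    have e2 : ((2 : ℕ) : ℝ) * -r = -(2 * r) := by push_cast; ring
    rw [e, Real.mul_rpow (by positivity) hc.le, Real.mul_rpow (by positivity) (by positivity),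
      ← Real.rpow_natCast A 2, ← Real.rpow_mul hA.le, e2, Real.rpow_neg hc.le,
      Real.rpow_neg (by positivity : (0 : ℝ) ≤ 2), Real.rpow_sub (by norm_num), Real.rpow_one]
    have := (Real.rpow_pos_of_pos hc r).ne'
    generalize (Real.pi * ((k : ℝ) + 1) / A) ^ r = X at this ⊢
    field_simp
  have hne : (((((2 * (k : ℝ) + 2) * Real.pi * A) ^ (-r) : ℝ)) : ℂ) ≠ 0 :=
    Complex.ofReal_ne_zero.2 (Real.rpow_pos_of_pos hx _).ne'
  rw [hd, h, hz, ← Complex.ofReal_cpow hx.le, ← hpow, Complex.ofReal_neg, besselK_neg]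
  generalize (2 * (k : ℝ) + 2) * Real.pi * A = x at hne ⊢
  rw [Complex.ofReal_mul, Complex.ofReal_mul, Complex.ofReal_ofNat, mul_assoc _ _ (_ / _),
    mul_div_cancel₀ _ hne]

lemma summable_dualIntegral_succ {r A : ℝ} (hr : 0 < r) (hA : 0 < A) :
    Summable fun k : ℕ => dualIntegral r A ((k : ℤ) + 1) := by
  obtain ⟨u, hu, hb⟩ := exists_summable_norm_besselK_div_cpow_le ((-r : ℝ) : ℂ)
    (neg_nonpos.2 hr.le) hA hA.le
  have h := (Summable.of_norm_bounded hu fun k => hb k A (by simp)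
    (by simp [abs_of_pos hA])).mul_left ((2 ^ (1 - r) * A ^ (-(2 * r)) : ℝ) : ℂ)
  simp_rw [← dualIntegral_succ hA] at h
  exact Complex.summable_ofReal.1 h

/-- Termwise integration of the theta transformation. -/
lemma Gamma_mul_tsum_eq_tsum_dualIntegral {μ A : ℝ} (hμ : 1 / 2 < μ) (hA : 0 < A)
    (hs : Summable fun n : ℤ => ((n : ℝ) ^ 2 + A ^ 2) ^ (-μ))
    (hd : Summable fun k : ℤ => dualIntegral (μ - 1 / 2) A k) :
    Real.Gamma μ * ∑' n : ℤ, ((n : ℝ) ^ 2 + A ^ 2) ^ (-μ) =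
      Real.sqrt Real.pi * ∑' k : ℤ, dualIntegral (μ - 1 / 2) A k := by
  have hμ0 : 0 < μ := by linarith
  have hΓ := Real.Gamma_pos_of_pos hμ0
  have h1 := integral_tsum_of_summable_integral_norm (μ := volume.restrict (Ioi (0 : ℝ)))
    (F := fun (n : ℤ) t => t ^ (μ - 1) * Real.exp (-(((n : ℝ) ^ 2 + A ^ 2) * t)))
    (fun n => .of_integral_ne_zero (by
      rw [integral_rpow_mul_exp_sq_add_sq hμ0 hA]
      positivity))
    ((hs.mul_left (Real.Gamma μ)).congr fun n => by
      rw [← integral_rpow_mul_exp_sq_add_sq hμ0 hA]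
      refine setIntegral_congr_fun measurableSet_Ioi fun t ht => ?_
      have ht : 0 < t := ht
      exact (Real.norm_of_nonneg (by positivity)).symm)
  have h2 := integral_tsum_of_summable_integral_norm (μ := volume.restrict (Ioi (0 : ℝ)))
    (F := fun (k : ℤ) t => t ^ (μ - 1 / 2 - 1) *
      Real.exp (-(A ^ 2 * t + Real.pi ^ 2 * (k : ℝ) ^ 2 / t)))
    (fun k => integrableOn_dualIntegral (by linarith) hA k)
    (hd.congr fun k => by
      refine setIntegral_congr_fun measurableSet_Ioi fun t ht => ?_
      have ht : 0 < t := ht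
      exact (Real.norm_of_nonneg (by positivity)).symm)
  simp_rw [integral_rpow_mul_exp_sq_add_sq hμ0 hA] at h1
  change ∑' k : ℤ, dualIntegral (μ - 1 / 2) A k = _ at h2
  rw [← tsum_mul_left, h1, h2, ← integral_const_mul]
  refine setIntegral_congr_fun measurableSet_Ioi fun t ht => ?_
  have ht : 0 < t := ht
  have e1 : ∀ n : ℤ, t ^ (μ - 1) * Real.exp (-(((n : ℝ) ^ 2 + A ^ 2) * t)) =
      t ^ (μ - 1) * Real.exp (-(A ^ 2 * t)) * Real.exp (-((n : ℝ) ^ 2 * t)) := fun n => by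
    rw [mul_assoc, ← Real.exp_add]
    ring_nf
  -- The shift by `1/2` is exactly the `t^(-1/2)` of the theta transformation.
  have e2 : ∀ k : ℤ, t ^ (μ - 1 / 2 - 1) *
      Real.exp (-(A ^ 2 * t + Real.pi ^ 2 * (k : ℝ) ^ 2 / t)) =
      t ^ (μ - 1) * t ^ (-(1 / 2) : ℝ) * Real.exp (-(A ^ 2 * t)) *
        Real.exp (-(Real.pi ^ 2 * (k : ℝ) ^ 2 / t)) := fun k => by
    rw [mul_assoc _ (Real.exp _), ← Real.exp_add, ← Real.rpow_add ht]
    ring_nf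
  simp only [e1, e2, tsum_mul_left, tsum_theta ht]
  ring

/-! ### The formula for positive real parameter -/

lemma tsum_inv_pow_eq_besselK_of_pos {μ A : ℝ} (hμ : 1 / 2 < μ) (hA : 0 < A) :
    ∑' n : ℕ, ((n : ℂ) ^ 2 + (A : ℂ) ^ 2) ^ (-(μ : ℂ)) =
      1 / (2 * (A : ℂ) ^ (2 * (μ : ℂ))) +
      (Real.sqrt Real.pi : ℂ) * Complex.Gamma ((μ : ℂ) - 1 / 2) /
        (2 * (A : ℂ) ^ (2 * (μ : ℂ) - 1) * Complex.Gamma (μ : ℂ)) +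
      (2 : ℂ) ^ (3 / 2 - (μ : ℂ)) * (Real.sqrt Real.pi : ℂ) /
        ((A : ℂ) ^ (2 * (μ : ℂ) - 1) * Complex.Gamma (μ : ℂ)) *
      ∑' k : ℕ,
        besselK (1 / 2 - (μ : ℂ)) ((2 * (k : ℂ) + 2) * (Real.pi : ℂ) * A) /
          ((2 * (k : ℂ) + 2) * (Real.pi : ℂ) * A) ^ (1 / 2 - (μ : ℂ)) := by
  have hr : 0 < μ - 1 / 2 := by linarith
  have hΓ := Real.Gamma_pos_of_pos (by linarith : 0 < μ)
  have ecast : ∀ n : ℕ, ((n : ℂ) ^ 2 + (A : ℂ) ^ 2) ^ (-(μ : ℂ)) =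
      ((((n : ℝ) ^ 2 + A ^ 2) ^ (-μ) : ℝ) : ℂ) := fun n => by
    rw [Complex.ofReal_cpow (by positivity)]
    push_cast
    rfl
  have hsN : Summable fun n : ℕ => ((n : ℝ) ^ 2 + A ^ 2) ^ (-μ) := by
    obtain ⟨u, hu, hb⟩ := exists_summable_norm_sq_add_sq_cpow_le hμ hA hA.le
    have h := Summable.of_norm_bounded hu fun n => hb n A (by simp) (by simp [abs_of_pos hA])
    simp_rw [ecast] at h
    exact Complex.summable_ofReal.1 h
  have hsN1 := ((summable_nat_add_iff 1).2 hsN).hasSum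
  -- Both integer sums split into `0`, `n + 1` and `-(n + 1)`; by evenness the two tails agree.
  have hsZ := HasSum.of_add_one_of_neg_add_one
    (f := fun n : ℤ => ((n : ℝ) ^ 2 + A ^ 2) ^ (-μ)) (by push_cast at hsN1 ⊢; exact hsN1)
    (by simp only [Int.cast_neg, neg_sq]; push_cast at hsN1 ⊢; exact hsN1)
  have hdN := (summable_dualIntegral_succ hr hA).hasSum
  have hdZ := HasSum.of_add_one_of_neg_add_one
    (f := fun k : ℤ => dualIntegral (μ - 1 / 2) A k) hdN
    (by simpa only [dualIntegral_neg] using hdN)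
  have key := Gamma_mul_tsum_eq_tsum_dualIntegral hμ hA hsZ.summable hdZ.summable
  rw [hsZ.tsum_eq, hdZ.tsum_eq, dualIntegral_zero hr hA] at key
  have h0 := hsN.tsum_eq_zero_add
  have hpow : ((((0 : ℤ) : ℝ)) ^ 2 + A ^ 2) ^ (-μ) = A ^ (-(2 * μ)) := by
    rw [Int.cast_zero, zero_pow two_ne_zero, zero_add, ← Real.rpow_natCast, ← Real.rpow_mul hA.le]
    norm_num
  have hpow' : (((0 : ℕ) : ℝ) ^ 2 + A ^ 2) ^ (-μ) = A ^ (-(2 * μ)) := by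
    simpa using hpow
  rw [hpow'] at h0
  rw [hpow] at key
  have hreal : ∑' n : ℕ, ((n : ℝ) ^ 2 + A ^ 2) ^ (-μ) = A ^ (-(2 * μ)) / 2 +
      Real.sqrt Real.pi * Real.Gamma (μ - 1 / 2) * A ^ (-(2 * (μ - 1 / 2))) /
        (2 * Real.Gamma μ) +
      Real.sqrt Real.pi / Real.Gamma μ *
        ∑' k : ℕ, dualIntegral (μ - 1 / 2) A ((k : ℤ) + 1) := by
    push_cast at h0
    rw [h0]
    generalize ∑' k : ℕ, dualIntegral (μ - 1 / 2) A ((k : ℤ) + 1) = D at key ⊢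
    generalize Real.Gamma (μ - 1 / 2) = G at key ⊢
    generalize A ^ (-(2 * (μ - 1 / 2))) = P at key ⊢
    field_simp
    linarith
  simp_rw [ecast]
  rw [← Complex.ofReal_tsum, hreal]
  push_cast
  simp_rw [dualIntegral_succ hA]
  rw [tsum_mul_left]
  have e1 : (((-(μ - 1 / 2) : ℝ)) : ℂ) = 1 / 2 - (μ : ℂ) := by push_cast; ring
  rw [e1, Complex.ofReal_mul, Complex.ofReal_cpow zero_le_two, Complex.ofReal_cpow hA.le,
    Complex.ofReal_cpow hA.le, ← Complex.Gamma_ofReal, ← Complex.Gamma_ofReal]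
  have hΓ' : Complex.Gamma (μ : ℂ) ≠ 0 := by
    rw [Complex.Gamma_ofReal]
    exact Complex.ofReal_ne_zero.2 hΓ.ne'
  have e2 : (((-(2 * (μ - 1 / 2)) : ℝ)) : ℂ) = -(2 * (μ : ℂ) - 1) := by push_cast; ring
  have e3 : (((-(2 * μ) : ℝ)) : ℂ) = -(2 * (μ : ℂ)) := by push_cast; ring
  have e4 : (((1 - (μ - 1 / 2) : ℝ)) : ℂ) = 3 / 2 - (μ : ℂ) := by push_cast; ring
  rw [e2, e3, e4, Complex.cpow_neg, Complex.cpow_neg]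
  push_cast
  generalize ∑' k : ℕ, besselK (1 / 2 - (μ : ℂ)) ((2 * (k : ℂ) + 2) * (Real.pi : ℂ) * A) /
    ((2 * (k : ℂ) + 2) * (Real.pi : ℂ) * A) ^ (1 / 2 - (μ : ℂ)) = S
  field_simp

/-! ### Analytic continuation to the right half-plane -/

lemma differentiableOn_tsum_of_locally_bounded {f : ℕ → ℂ → ℂ}
    (hf : ∀ n a, 0 < a.re → DifferentiableAt ℂ (f n) a)
    (hb : ∀ δ R : ℝ, 0 < δ → 0 ≤ R → ∃ u : ℕ → ℝ, Summable u ∧ ∀ (n : ℕ) (a : ℂ),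
      δ ≤ a.re → ‖a‖ ≤ R → ‖f n a‖ ≤ u n) :
    DifferentiableOn ℂ (fun a => ∑' n, f n a) {a | 0 < a.re} := by
  intro a ha
  have ha : 0 < a.re := ha
  obtain ⟨u, hu, hub⟩ := hb (a.re / 2) (‖a‖ + 1) (by linarith) (by positivity)
  have hU : IsOpen {w : ℂ | a.re / 2 < w.re ∧ ‖w‖ < ‖a‖ + 1} :=
    (isOpen_lt continuous_const Complex.continuous_re).inter
      (isOpen_lt continuous_norm continuous_const)
  have h := differentiableOn_tsum_of_summable_norm (F := f) hu
    (fun n w hw => (hf n w (by have := hw.1; linarith)).differentiableWithinAt) hU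
    (fun n w hw => hub n w hw.1.le hw.2.le)
  exact (h.differentiableAt (hU.mem_nhds ⟨by linarith, by linarith⟩)).differentiableWithinAt

/-- Keeps the principal power holomorphic: the imaginary part `2 Re a Im a` vanishes only for real
`a`, where the value is positive. -/
lemma sq_add_sq_mem_slitPlane (n : ℕ) {a : ℂ} (ha : 0 < a.re) :
    (n : ℂ) ^ 2 + a ^ 2 ∈ Complex.slitPlane := by
  rw [Complex.mem_slitPlane_iff]
  by_cases him : a.im = 0
  · left
    simp [sq, him]
    positivity
  · right
    have h : ((n : ℂ) ^ 2 + a ^ 2).im = 2 * a.re * a.im := by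
      simp [sq]
      ring
    rw [h]
    exact mul_ne_zero (by positivity) him

theorem mainTheorem5 (μ : ℝ) (hμ : 1 / 2 < μ) (a : ℂ) (ha : a ≠ 0)
    (harg : |Complex.arg a| < Real.pi / 2) :
    Summable (fun n : ℕ => (((n : ℂ) ^ 2 + a ^ 2) ^ (-(μ : ℂ)))) ∧
    Summable (fun k : ℕ =>
      besselK (1 / 2 - (μ : ℂ)) ((2 * (k : ℂ) + 2) * (Real.pi : ℂ) * a) /
        ((2 * (k : ℂ) + 2) * (Real.pi : ℂ) * a) ^ (1 / 2 - (μ : ℂ))) ∧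
    ∑' n : ℕ, ((n : ℂ) ^ 2 + a ^ 2) ^ (-(μ : ℂ)) =
      1 / (2 * a ^ (2 * (μ : ℂ))) +
      (Real.sqrt Real.pi : ℂ) * Complex.Gamma ((μ : ℂ) - 1 / 2) /
        (2 * a ^ (2 * (μ : ℂ) - 1) * Complex.Gamma (μ : ℂ)) +
      (2 : ℂ) ^ (3 / 2 - (μ : ℂ)) * (Real.sqrt Real.pi : ℂ) /
        (a ^ (2 * (μ : ℂ) - 1) * Complex.Gamma (μ : ℂ)) *
      ∑' k : ℕ,
        besselK (1 / 2 - (μ : ℂ)) ((2 * (k : ℂ) + 2) * (Real.pi : ℂ) * a) /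
          ((2 * (k : ℂ) + 2) * (Real.pi : ℂ) * a) ^ (1 / 2 - (μ : ℂ)) := by
  have hre : 0 < a.re := (Complex.abs_arg_lt_pi_div_two_iff.1 harg).resolve_right ha
  have hΓ : Complex.Gamma (μ : ℂ) ≠ 0 := by
    rw [Complex.Gamma_ofReal]
    exact Complex.ofReal_ne_zero.2 (Real.Gamma_pos_of_pos (by linarith)).ne'
  have hb1 := fun (δ R : ℝ) (hδ : 0 < δ) (hR : 0 ≤ R) =>
    exists_summable_norm_sq_add_sq_cpow_le hμ hδ hR
  have hb2 := fun (δ R : ℝ) (hδ : 0 < δ) (hR : 0 ≤ R) =>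
    exists_summable_norm_besselK_div_cpow_le (1 / 2 - (μ : ℂ)) (s := 1 / 2 - μ) (by linarith) hδ hR
  have e1 : (((1 / 2 - μ : ℝ)) : ℂ) = 1 / 2 - (μ : ℂ) := by push_cast; rfl
  simp_rw [e1] at hb2
  have hz : ∀ (k : ℕ) (w : ℂ), 0 < w.re → 0 < ((2 * (k : ℂ) + 2) * (Real.pi : ℂ) * w).re := by
    intro k w hw
    have h : (2 * (k : ℂ) + 2) * (Real.pi : ℂ) = (((2 * (k : ℝ) + 2) * Real.pi : ℝ) : ℂ) := by
      push_cast
      rfl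
    rw [h, Complex.re_ofReal_mul]
    have := Real.pi_pos
    positivity
  have hslit : ∀ w : ℂ, 0 < w.re → w ∈ Complex.slitPlane := fun w hw => Or.inl hw
  have hne : ∀ w : ℂ, 0 < w.re → w ≠ 0 := fun w hw => Complex.slitPlane_ne_zero (hslit w hw)
  have hU : IsOpen {w : ℂ | 0 < w.re} := isOpen_lt continuous_const Complex.continuous_re
  have hL := differentiableOn_tsum_of_locally_bounded
    (f := fun n w => ((n : ℂ) ^ 2 + w ^ 2) ^ (-(μ : ℂ)))
    (fun n w hw => DifferentiableAt.cpow_const (by fun_prop) (sq_add_sq_mem_slitPlane n hw)) hb1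
  have hB := differentiableOn_tsum_of_locally_bounded
    (f := fun k w => besselK (1 / 2 - (μ : ℂ)) ((2 * (k : ℂ) + 2) * (Real.pi : ℂ) * w) /
      ((2 * (k : ℂ) + 2) * (Real.pi : ℂ) * w) ^ (1 / 2 - (μ : ℂ)))
    (fun k w hw => by
      refine DifferentiableAt.div ?_ ?_ ?_
      · exact (differentiableAt_besselK _ (hz k w hw)).comp w (by fun_prop)
      · exact DifferentiableAt.cpow_const (by fun_prop) (hslit _ (hz k w hw))
      · exact fun h => hne _ (hz k w hw) ((Complex.cpow_eq_zero_iff _ _).1 h).1) hb2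
  have hpow : ∀ s : ℂ, DifferentiableOn ℂ (fun w : ℂ => w ^ s) {w : ℂ | 0 < w.re} :=
    fun s w hw => (DifferentiableAt.cpow_const (by fun_prop)
      (hslit w hw)).differentiableWithinAt
  have hpne : ∀ (s w : ℂ), 0 < w.re → w ^ s ≠ 0 :=
    fun s w hw h => hne _ hw ((Complex.cpow_eq_zero_iff _ _).1 h).1
  have hR := ((DifferentiableOn.div (differentiableOn_const (1 : ℂ))
    ((hpow (2 * (μ : ℂ))).const_mul (2 : ℂ)) (fun w hw => mul_ne_zero two_ne_zero (hpne _ w hw))).add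
    (DifferentiableOn.div
      (differentiableOn_const ((Real.sqrt Real.pi : ℂ) * Complex.Gamma ((μ : ℂ) - 1 / 2)))
      (((hpow (2 * (μ : ℂ) - 1)).const_mul (2 : ℂ)).mul_const (Complex.Gamma (μ : ℂ)))
      (fun w hw => mul_ne_zero (mul_ne_zero two_ne_zero (hpne _ w hw)) hΓ))).add
    ((DifferentiableOn.div
      (differentiableOn_const ((2 : ℂ) ^ (3 / 2 - (μ : ℂ)) * (Real.sqrt Real.pi : ℂ)))
      ((hpow (2 * (μ : ℂ) - 1)).mul_const (Complex.Gamma (μ : ℂ)))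
      (fun w hw => mul_ne_zero (hpne _ w hw) hΓ)).mul hB)
  refine ⟨?_, ?_, ?_⟩
  · obtain ⟨u, hu, hub⟩ := hb1 a.re ‖a‖ hre (norm_nonneg a)
    exact .of_norm_bounded hu fun n => hub n a le_rfl le_rfl
  · obtain ⟨u, hu, hub⟩ := hb2 a.re ‖a‖ hre (norm_nonneg a)
    exact .of_norm_bounded hu fun n => hub n a le_rfl le_rfl
  · refine (hL.analyticOnNhd hU).eqOn_of_preconnected_of_frequently_eq (hR.analyticOnNhd hU)
      (convex_halfSpace_re_gt 0).isPreconnected (z₀ := 1) (by simp) ?_ hre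
    -- Real points other than `1` accumulate at `1`, so agreement on the positive reals suffices.
    have ht : Tendsto (fun x : ℝ => (x : ℂ)) (𝓝[≠] 1) (𝓝[≠] 1) := by
      refine tendsto_nhdsWithin_of_tendsto_nhds_of_eventually_within _ ?_ ?_
      · exact (Complex.continuous_ofReal.tendsto' 1 1 (by simp)).mono_left nhdsWithin_le_nhds
      · filter_upwards [self_mem_nhdsWithin] with x hx
        simpa using hx
    refine ht.frequently (Eventually.frequently ?_)
    filter_upwards [nhdsWithin_le_nhds (eventually_gt_nhds (zero_lt_one (α := ℝ)))] with A hA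
    exact tsum_inv_pow_eq_besselK_of_pos hμ hA
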